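/- Fix $T>0$ and let $B=C_0([0,T];\mathbb C)$ be the complex Banach space of continuous functions $z:[0,T]\to\mathbb C$ with $z(0)=0$, with the sup norm; for $t\in[0,T]$ let $\delta_t\in B'$, $\delta_t(z)=z(t)=\int z\,\mathrm d\delta_t$. A $B$-valued proper Gaussian field is a Borel measurable map $Z$ from a probability space to $B$ such that for every $f\in B'$ the pair $(\operatorname{Re} f(Z),\operatorname{Im} f(Z))$ is Gaussian, and $\mathbb E f(Z)=0$, $\mathbb E[f(Z)g(Z)]=0$ for all $f,g\in B'$. (i) There is a $B$-valued proper Gaussian field $Z$ on some probability space such that $W_t:=\delta_t(Z)$, $t\in[0,T]$, is complex Brownian motion: almost surely $t\mapsto W_t$ is continuous with $W_0=0$, $W$ has independent increments, and for $0\le s\le t\le T$ the increment $W_t-W_s$ is a (for $s=t$ degenerate) proper complex Gaussian variable, i.e. Gaussian in $\mathbb C=\mathbb R^2$ with $\mathbb E(W_t-W_s)=0$ and $\mathbb E(W_t-W_s)^2=0$, of variance $\mathbb E|W_t-W_s|^2=t-s$. (ii) For $x_0\in\mathbb C$ let $C_{x_0}([0,T])$ be the set of continuous functions $x:[0,T]\to\mathbb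 C$ with $x(0)=x_0$, with the sup metric. For every $x_0\in\mathbb C$ there is a unique Borel measure $\nu_{x_0}$ on $C_{x_0}([0,T])$ such that for all $n\in\mathbb N$, all $0=:t_0<t_1<\dots<t_n\le T$ and all non-negative measurable $f:\mathbb C^n\to\mathbb R$ $$\int_{C_{x_0}([0,T])} f\big(x(t_1),\dots,x(t_n)\big)\,\mathrm d\nu_{x_0}(x)=\kappa\int_{\mathbb C^n} f(x_1,\dots,x_n)\exp\Big(-\frac12\sum_{k=1}^n\frac{|x_k-x_{k-1}|^2}{t_k-t_{k-1}}\Big)\,\mathrm dx,\qquad \kappa=\prod_{k=1}^n\frac1{2\pi(t_k-t_{k-1})},$$ where both sides may be $+\infty$; it is the law of $x_0+\sqrt2\,W$, with $W$ as in (i). (iii) Likewise, for every $x_0\in\mathbb C$ the law of $x_0+W$ itself is the unique Borel measure on $C_{x_0}([0,T])$ that satisfies this formula, for the same $n$, $t_k$ and $f$, with $\exp\big(-\sum_{k}|x_k-x_{k-1}|^2/(t_k-t_{k-1})\big)$ in place of the exponential and $\kappa=\prod_{k}\frac1{\pi(t_k-t_{k-1})}$. -/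

import Mathlib

open MeasureTheory ProbabilityTheory Set
open scoped NNReal ENNReal

noncomputable section

namespace ComplexWiener

/-! ### Complex random variables -/

section RandomVariables

variable {Ω : Type*} {mΩ : MeasurableSpace Ω}

/-- The variance `E |Z - E Z|²` of a complex random variable. -/
def cVar (Z : Ω → ℂ) (P : Measure Ω) : ℝ :=
  ∫ ω, ‖Z ω - ∫ ω', Z ω' ∂P‖ ^ 2 ∂P

/-- The pseudo-covariance `E [(Z - E Z) (Z' - E Z')]` of two complex random variables
(no complex conjugation). -/
def pCov (Z Z' : Ω → ℂ) (P : Measure Ω) : ℂ :=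
  ∫ ω, (Z ω - ∫ ω', Z ω' ∂P) * (Z' ω - ∫ ω', Z' ω' ∂P) ∂P

/-- The pseudo-variance `E [(Z - E Z)²]`. -/
def pVar (Z : Ω → ℂ) (P : Measure Ω) : ℂ := pCov Z Z P

/-- A complex random variable is *proper* if it has zero mean, finite variance and zero
pseudo-variance. -/
structure IsProper (Z : Ω → ℂ) (P : Measure Ω) : Prop where
  measurable : Measurable Z
  finite_variance : MemLp Z 2 P
  mean_eq_zero : ∫ ω, Z ω ∂P = 0
  pVar_eq_zero : pVar Z P = 0

/-- A *proper complex Gaussian* random variable: proper, and Gaussian as a random vector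
in `ℂ = ℝ²` (possibly degenerate). -/
structure IsProperGaussian (Z : Ω → ℂ) (P : Measure Ω) : Prop where
  gaussian : HasGaussianLaw Z P
  proper : IsProper Z P

/-- A *proper Gaussian field* with values in a complex Banach space `E`: a Borel measurable
map `X : Ω → E` such that `f (X)` is a complex Gaussian random variable for each continuous
linear functional `f`, and whose mean and pseudo-covariance functions vanish. -/
structure IsProperGaussianField {E : Type*} [NormedAddCommGroup E] [NormedSpace ℂ E]
    [MeasurableSpace E] [BorelSpace E] (X : Ω → E) (P : Measure Ω) : Prop where
  measurable : Measurable X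
  gaussian : ∀ f : StrongDual ℂ E, HasGaussianLaw (fun ω ↦ f (X ω)) P
  finite_variance : ∀ f : StrongDual ℂ E, MemLp (fun ω ↦ f (X ω)) 2 P
  mean_eq_zero : ∀ f : StrongDual ℂ E, ∫ ω, f (X ω) ∂P = 0
  pCov_eq_zero : ∀ f g : StrongDual ℂ E, pCov (fun ω ↦ f (X ω)) (fun ω ↦ g (X ω)) P = 0

/-- *Complex Brownian motion* on `[0, T]`: almost surely continuous and starting in zero, with
independent increments, the increment over `[s, t]` being a proper complex Gaussian of variance
`E |W t - W s|² = t - s`. -/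
structure IsComplexBrownianMotion {T : ℝ} (W : Icc (0 : ℝ) T → Ω → ℂ) (P : Measure Ω) :
    Prop where
  measurable : ∀ t, Measurable (W t)
  start_zero : ∀ᵐ ω ∂P, ∀ t : Icc (0 : ℝ) T, (t : ℝ) = 0 → W t ω = 0
  continuous_paths : ∀ᵐ ω ∂P, Continuous fun t ↦ W t ω
  indep_increments : HasIndepIncrements W P
  gaussian_increments : ∀ s t : Icc (0 : ℝ) T, s ≤ t →
    IsProperGaussian (fun ω ↦ W t ω - W s ω) P
  var_increments : ∀ s t : Icc (0 : ℝ) T, s ≤ t →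
    cVar (fun ω ↦ W t ω - W s ω) P = (t : ℝ) - s

end RandomVariables

/-! ### Path spaces -/

/-- The Borel `σ`-algebra of the Banach space `C([0, T]; ℂ)` (sup norm); the path spaces below
carry the induced topology and `σ`-algebra, which is again Borel. -/
instance instMeasurableSpacePaths (T : ℝ) : MeasurableSpace C(Icc (0 : ℝ) T, ℂ) := borel _

instance instBorelSpacePaths (T : ℝ) : BorelSpace C(Icc (0 : ℝ) T, ℂ) := ⟨rfl⟩

/-- The complex Banach space `C₀([0, T]; ℂ)` of continuous paths starting in zero,
with the sup norm. -/
def wienerSpace (T : ℝ) : Submodule ℂ C(Icc (0 : ℝ) T, ℂ) where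
  carrier := {z | ∀ t : Icc (0 : ℝ) T, (t : ℝ) = 0 → z t = 0}
  add_mem' := fun ha hb t ht ↦ by simp [ha t ht, hb t ht]
  zero_mem' := fun t _ ↦ by simp
  smul_mem' := fun c z hz t ht ↦ by simp [hz t ht]

/-- The space `C_{x₀}([0, T])` of continuous paths `[0, T] → ℂ` starting in `x₀`. -/
abbrev PathsFrom (T : ℝ) (x₀ : ℂ) : Type :=
  {x : C(Icc (0 : ℝ) T, ℂ) // ∀ t : Icc (0 : ℝ) T, (t : ℝ) = 0 → x t = x₀}

/-- The shift `z ↦ x₀ + z` from `C₀([0, T]; ℂ)` to `C_{x₀}([0, T])`. -/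
def shift {T : ℝ} (x₀ : ℂ) (z : wienerSpace T) : PathsFrom T x₀ :=
  ⟨ContinuousMap.const _ x₀ + z.1, fun t ht ↦ by simp [z.2 t ht]⟩

/-- The evaluation functional `δ t : z ↦ z t` on `C₀([0, T]; ℂ)`. -/
def δ {T : ℝ} (t : Icc (0 : ℝ) T) : StrongDual ℂ (wienerSpace T) :=
  (ContinuousMap.evalCLM ℂ t).comp (wienerSpace T).subtypeL

/-- `δ t` is integration against the Dirac measure in `t`. -/
theorem δ_eq_integral_dirac {T : ℝ} (t : Icc (0 : ℝ) T) (z : wienerSpace T) :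
    δ t z = ∫ s, z.1 s ∂(Measure.dirac t) := by
  rw [integral_dirac]
  rfl

/-- `ν` has the complex Gaussian finite-dimensional distributions with starting point `x₀` and
variance `v` per unit of time: for `0 = t₀ < t₁ < ⋯ < tₙ ≤ T` and measurable `f ≥ 0`,
`∫ f (x t₁, …, x tₙ) dν = κ ∫ f (x) exp (-(1/v) ∑ |xₖ - xₖ₋₁|² / (tₖ - tₖ₋₁)) dx`
over `ℂⁿ = ℝ²ⁿ`, both sides in `[0, ∞]`, with
`κ = ∏ (π v (tₖ - tₖ₋₁))⁻¹` the constant that normalises the Gaussian density. -/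
def HasComplexGaussianFDD {T : ℝ} (x₀ : ℂ) (v : ℝ) (ν : Measure (PathsFrom T x₀)) : Prop :=
  ∀ (n : ℕ) (t : Fin (n + 1) → Icc (0 : ℝ) T), StrictMono t → (t 0 : ℝ) = 0 →
    ∀ f : (Fin n → ℂ) → ℝ≥0, Measurable f →
      ∫⁻ x, (f fun k ↦ x.1 (t k.succ)) ∂ν =
        ENNReal.ofReal (∏ k : Fin n, (Real.pi * v * ((t k.succ : ℝ) - t k.castSucc))⁻¹) *
          ∫⁻ x : Fin n → ℂ, f x * ENNReal.ofReal (Real.exp (-(1 / v) *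
            ∑ k : Fin n, ‖x k - (Fin.cons x₀ x : Fin (n + 1) → ℂ) k.castSucc‖ ^ 2 /
              ((t k.succ : ℝ) - t k.castSucc)))

end ComplexWiener

end

/-! Wiener measure is built as the law of a Lévy–Ciesielski series. A Brownian bridge `B` on `[0,
1]` expands in tent functions, and `(1 + t) B (t / (1 + t))` is a Brownian motion on all of `[0,
∞)`, so every `T` is covered by one bridge and no linear term is needed. With independent standard
Gaussian coefficients in `ℂ = ℝ²` the series converges uniformly almost surely
(`ae_summable_seriesBlock`), and each real functional of the limit is centred Gaussian with variance
the sum of the variances of the terms (`exists_isSeriesLaw`).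

Everything else in (i) is read off from these one-dimensional laws. They are invariant under
multiplication by `I`, which makes the field proper (`isProperGaussianField_id`). Polarisation gives
the covariances, which for evaluations reduce to `min s t` by completeness of the Haar system
(`sum_tent_mul_tent`); uncorrelated increments of a jointly Gaussian family are independent.

For (ii) and (iii), the independent increments have explicit densities, and passing from a sequence
of positions to its increments preserves Lebesgue measure (`measurePreserving_increments`), so the
product density becomes the stated one. Uniqueness holds because the formula fixes all
finite-dimensional marginals, and the values on a countable dense set of times embed the path space
measurably into a product (`HasComplexGaussianFDD.unique`). -/

namespace ComplexWiener

/-! ### Tent functions, the bridge covariance and the Schauder system -/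

/-- The tent function: `x ↦ min x (1 - x)` on `[0, 1]`, zero elsewhere. -/
noncomputable def tent (x : ℝ) : ℝ := max 0 (min x (1 - x))

theorem continuous_tent : Continuous tent := by unfold tent; fun_prop

theorem tent_nonneg (x : ℝ) : 0 ≤ tent x := le_max_left _ _

theorem tent_le_one (x : ℝ) : tent x ≤ 1 := by
  unfold tent
  grind

theorem mem_Ioo_of_tent_ne_zero {x : ℝ} (hx : tent x ≠ 0) : 0 < x ∧ x < 1 := by
  unfold tent at hx
  grind

/-- Integer translates of the tent have disjoint open supports, so at most one term is nonzero. -/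
theorem sum_tent_sub_le_one (s : Finset ℕ) (x : ℝ) : ∑ k ∈ s, tent (x - k) ≤ 1 := by
  by_cases h : ∃ k ∈ s, tent (x - k) ≠ 0
  · obtain ⟨k, hk, hk0⟩ := h
    rw [Finset.sum_eq_single_of_mem k hk]
    · exact tent_le_one _
    · intro j _ hjk
      by_contra hj
      have h1 := mem_Ioo_of_tent_ne_zero hk0
      have h2 := mem_Ioo_of_tent_ne_zero hj
      have h3 : (j : ℝ) < k + 1 := by linarith
      have h4 : (k : ℝ) < j + 1 := by linarith
      norm_cast at h3 h4
      omega
  · push Not at h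
    rw [Finset.sum_eq_zero h]
    exact zero_le_one

/-- The covariance function of the Brownian bridge on `[0, 1]`, extended by zero. -/
noncomputable def bridgeCov (s t : ℝ) : ℝ :=
  if 0 ≤ s ∧ s ≤ 1 ∧ 0 ≤ t ∧ t ≤ 1 then min s t - s * t else 0

theorem bridgeCov_nonneg (s t : ℝ) : 0 ≤ bridgeCov s t := by
  unfold bridgeCov
  split_ifs with h
  · rcases le_total s t with h' | h'
    · rw [min_eq_left h']; nlinarith
    · rw [min_eq_right h']; nlinarith
  · exact le_rfl

theorem bridgeCov_le_tent (s t : ℝ) : bridgeCov s t ≤ tent s := by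
  unfold bridgeCov
  split_ifs with h
  · refine le_trans ?_ (le_max_right _ _)
    rcases le_total s t with h' | h'
    · rw [min_eq_left h']; apply le_min <;> nlinarith
    · rw [min_eq_right h']; apply le_min <;> nlinarith
  · exact tent_nonneg _

/-- Self-similarity of the bridge: given its value at `1/2`, which has variance `1/4` and is
interpolated by `2 * tent`, what remains is two independent bridges on the halves, each with
covariance scaled by `1/2`. -/
theorem bridgeCov_eq_tent_mul_tent_add (s t : ℝ) :
    bridgeCov s t = tent s * tent t +
      2⁻¹ * (bridgeCov (2 * s) (2 * t) + bridgeCov (2 * s - 1) (2 * t - 1)) := by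
  unfold bridgeCov tent
  rcases lt_trichotomy s 2⁻¹ with hs | rfl | hs <;> rcases lt_trichotomy t 2⁻¹ with ht | rfl | ht <;>
  grind (splits := 20)

theorem sum_range_two_mul (f : ℕ → ℝ) (m : ℕ) :
    ∑ k ∈ Finset.range (2 * m), f k = ∑ k ∈ Finset.range m, (f (2 * k) + f (2 * k + 1)) := by
  induction m with
  | zero => simp
  | succ m ih =>
    rw [show 2 * (m + 1) = 2 * m + 1 + 1 by ring, Finset.sum_range_succ, Finset.sum_range_succ,
      Finset.sum_range_succ, ih, add_assoc]

/-- Completeness of the Haar system, for the primitives of the Haar functions. -/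
theorem sum_tent_mul_tent (s t : ℝ) (N : ℕ) :
    ∑ n ∈ Finset.range N, (2⁻¹ : ℝ) ^ n *
        ∑ k ∈ Finset.range (2 ^ n), tent (2 ^ n * s - k) * tent (2 ^ n * t - k) =
      bridgeCov s t - (2⁻¹ : ℝ) ^ N *
        ∑ k ∈ Finset.range (2 ^ N), bridgeCov (2 ^ N * s - k) (2 ^ N * t - k) := by
  induction N with
  | zero => simp
  | succ N ih =>
    rw [Finset.sum_range_succ, ih, pow_succ' 2 N, sum_range_two_mul]
    simp_rw [fun k : ℕ ↦ bridgeCov_eq_tent_mul_tent_add (2 ^ N * s - k) (2 ^ N * t - k)]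
    rw [Finset.sum_add_distrib, ← Finset.mul_sum]
    have h (k : ℕ) (x : ℝ) : 2 ^ (N + 1) * x - ((2 * k : ℕ) : ℝ) = 2 * (2 ^ N * x - k) := by
      push_cast; ring
    have h' (k : ℕ) (x : ℝ) :
        2 ^ (N + 1) * x - ((2 * k + 1 : ℕ) : ℝ) = 2 * (2 ^ N * x - k) - 1 := by
      push_cast; ring
    simp_rw [h, h']
    rw [pow_succ]
    ring

theorem tendsto_sum_tent_mul_tent (s t : ℝ) :
    Filter.Tendsto (fun N ↦ ∑ n ∈ Finset.range N, (2⁻¹ : ℝ) ^ n *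
        ∑ k ∈ Finset.range (2 ^ n), tent (2 ^ n * s - k) * tent (2 ^ n * t - k))
      Filter.atTop (nhds (bridgeCov s t)) := by
  simp_rw [sum_tent_mul_tent]
  have h0 : Filter.Tendsto (fun N : ℕ ↦ (2⁻¹ : ℝ) ^ N) Filter.atTop (nhds 0) :=
    tendsto_pow_atTop_nhds_zero_of_lt_one (by norm_num) (by norm_num)
  have : Filter.Tendsto (fun N : ℕ ↦ (2⁻¹ : ℝ) ^ N *
      ∑ k ∈ Finset.range (2 ^ N), bridgeCov (2 ^ N * s - k) (2 ^ N * t - k))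
      Filter.atTop (nhds 0) := by
    refine squeeze_zero (fun N ↦ mul_nonneg (by positivity)
      (Finset.sum_nonneg fun k _ ↦ bridgeCov_nonneg _ _)) (fun N ↦ ?_) h0
    -- The remainder is at most `2⁻¹ ^ N`: its sum is dominated by translated tents, of which at
    -- most one is nonzero.
    refine mul_le_of_le_one_right (by positivity) ?_
    exact (Finset.sum_le_sum fun k _ ↦ bridgeCov_le_tent _ _).trans (sum_tent_sub_le_one _ _)
  simpa using tendsto_const_nhds.sub this

/-- The elements of the Lévy–Ciesielski basis of `C₀([0, T]; ℂ)` after the change of time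
`t ↦ t / (1 + t)` that turns a Brownian bridge into a Brownian motion, scaled such that their
sums against standard Gaussian vectors in `ℂ = ℝ²` have unit variance at time one. -/
noncomputable def schauder (T : ℝ) (n k : ℕ) : wienerSpace T :=
  ⟨⟨fun t ↦ (((1 + t) * (√2⁻¹ ^ (n + 1) * tent (2 ^ n * (t / (1 + t)) - k)) : ℝ) : ℂ), by
    have (t : Icc (0 : ℝ) T) : (1 + (t : ℝ)) ≠ 0 := by have := t.2.1; positivity
    have := continuous_tent
    fun_prop (disch := assumption)⟩, by
    intro t ht
    have : tent (-(k : ℝ)) = 0 := max_eq_left ((min_le_left _ _).trans (by simp))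
    simp [ht, this]⟩

theorem schauder_apply (T : ℝ) (n k : ℕ) (t : Icc (0 : ℝ) T) :
    (schauder T n k).1 t =
      (((1 + t) * (√2⁻¹ ^ (n + 1) * tent (2 ^ n * (t / (1 + t)) - k)) : ℝ) : ℂ) := rfl

/-- Within one level the supports do not overlap, so the sup norm sees only the largest coefficient.
This is the only norm estimate on the basis that the Gaussian series needs. -/
theorem norm_sum_smul_schauder_le {T : ℝ} (hT : 0 ≤ T) (n : ℕ) (c : ℕ → ℂ) (M : ℝ)
    (hc : ∀ k < 2 ^ n, ‖c k‖ ≤ M) :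
    ‖∑ k ∈ Finset.range (2 ^ n), c k • schauder T n k‖ ≤ (1 + T) * √2⁻¹ ^ n * M := by
  have hM : 0 ≤ M := (norm_nonneg _).trans (hc 0 (by positivity))
  rw [← Submodule.norm_coe, ContinuousMap.norm_le _ (by positivity)]
  intro t
  have h1 : ((∑ k ∈ Finset.range (2 ^ n), c k • schauder T n k : wienerSpace T) :
      C(Icc (0 : ℝ) T, ℂ)) t = ∑ k ∈ Finset.range (2 ^ n), c k * (schauder T n k).1 t := by
    simp [ContinuousMap.sum_apply]
  have h0 := t.2.1
  have hr : √2⁻¹ ≤ (1 : ℝ) := Real.sqrt_le_one.2 (by norm_num)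
  rw [h1]
  calc _ ≤ ∑ k ∈ Finset.range (2 ^ n), (1 + T) * √2⁻¹ ^ n * M *
          tent (2 ^ n * (t / (1 + t)) - k) := by
        refine norm_sum_le_of_le _ fun k hk ↦ ?_
        rw [norm_mul, schauder_apply, Complex.norm_real, Real.norm_of_nonneg (by
          have := tent_nonneg (2 ^ n * (t / (1 + t)) - k); positivity)]
        have h2 := hc k (Finset.mem_range.1 hk)
        have h3 := tent_nonneg (2 ^ n * (t / (1 + t)) - k)
        have h4 : √2⁻¹ ^ (n + 1) ≤ (√2⁻¹ : ℝ) ^ n :=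
          pow_le_pow_of_le_one (by positivity) hr (by simp)
        have h5 : (1 + t : ℝ) ≤ 1 + T := by linarith [t.2.2]
        calc _ ≤ M * ((1 + T) * (√2⁻¹ ^ n * tent (2 ^ n * (t / (1 + t)) - k))) := by gcongr
          _ = _ := by ring
    _ ≤ _ := by
        rw [← Finset.mul_sum]
        exact mul_le_of_le_one_right (by positivity) (sum_tent_sub_le_one _ _)

/-- The time change turns the bridge covariance into `min s t / ((1 + s) * (1 + t))`, and the
prefactors cancel the denominator. The `1/2` compensates for `E |z|² = 2` under `stdGaussian ℂ`. -/
theorem tendsto_sum_schauder_mul_schauder {T : ℝ} (s t : Icc (0 : ℝ) T) :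
    Filter.Tendsto (fun N ↦ ∑ n ∈ Finset.range N, ∑ k ∈ Finset.range (2 ^ n),
        ((schauder T n k).1 s).re * ((schauder T n k).1 t).re)
      Filter.atTop (nhds (min (s : ℝ) t / 2)) := by
  have hs := s.2.1
  have ht := t.2.1
  convert (tendsto_sum_tent_mul_tent (s / (1 + s)) (t / (1 + t))).const_mul
    ((1 + s) * (1 + t) / 2 : ℝ) using 2
  · rw [Finset.mul_sum]
    refine Finset.sum_congr rfl fun n _ ↦ ?_
    rw [Finset.mul_sum, Finset.mul_sum]
    refine Finset.sum_congr rfl fun k _ ↦ ?_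
    have : (√2⁻¹ : ℝ) ^ (n + 1) * √2⁻¹ ^ (n + 1) = 2⁻¹ ^ n / 2 := by
      rw [← mul_pow, Real.mul_self_sqrt (by norm_num), pow_succ]; ring
    simp only [schauder_apply, Complex.ofReal_re]
    linear_combination (1 + s : ℝ) * (1 + t) * tent (2 ^ n * (s / (1 + s)) - k) *
      tent (2 ^ n * (t / (1 + t)) - k) * this
  · rw [bridgeCov, if_pos ⟨by positivity, by rw [div_le_one₀] <;> linarith, by positivity,
      by rw [div_le_one₀] <;> linarith⟩]
    rcases le_total (s : ℝ) t with h | h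
    · have : (s : ℝ) / (1 + s) ≤ t / (1 + t) := by
        rw [div_le_div_iff₀ (by positivity) (by positivity)]; linarith
      rw [min_eq_left this, min_eq_left h]
      field_simp
      ring
    · have : (t : ℝ) / (1 + t) ≤ s / (1 + s) := by
        rw [div_le_div_iff₀ (by positivity) (by positivity)]; linarith
      rw [min_eq_right this, min_eq_right h]
      field_simp
      ring

/-! ### Gaussian series in a Banach space: convergence and law -/

section GaussianSeries

open Filter Topology

theorem map_sum_inner_infinitePi_stdGaussian {ι : Type*} (F : Finset ι) (c : ι → ℂ) :
    (Measure.infinitePi fun _ : ι ↦ stdGaussian ℂ).map (fun ω ↦ ∑ p ∈ F, inner ℝ (c p) (ω p)) =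
      gaussianReal 0 (∑ p ∈ F, ‖c p‖₊ ^ 2) := by
  have hind := iIndepFun_infinitePi (P := fun _ : ι ↦ stdGaussian ℂ)
    (X := fun p z ↦ inner ℝ (c p) z) (fun p ↦ by fun_prop)
  have hlaw (p : ι) : (Measure.infinitePi fun _ : ι ↦ stdGaussian ℂ).map
      (fun ω ↦ inner ℝ (c p) (ω p)) = gaussianReal 0 (‖c p‖₊ ^ 2) := by
    have h1 : (fun ω : ι → ℂ ↦ inner ℝ (c p) (ω p)) =
        innerSL ℝ (c p) ∘ (fun ω ↦ ω p) := by ext; simp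
    rw [h1, ← Measure.map_map (by fun_prop) (by fun_prop),
      Measure.infinitePi_map_eval (fun _ : ι ↦ stdGaussian ℂ) p,
      IsGaussian.map_eq_gaussianReal, integral_strongDual_stdGaussian, variance_dual_stdGaussian,
      innerSL_apply_norm]
    congr
    ext
    simp
  apply Measure.ext_of_charFun
  rw [iIndepFun.charFun_map_fun_finsetSum_eq_prod 
    (fun p _ ↦ Measurable.aemeasurable (by fun_prop)) (hind.restrict F)]
  ext t
  simp_rw [Finset.prod_apply, hlaw, charFun_gaussianReal, ← Complex.exp_sum]
  congr 1
  push_cast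
  rw [Finset.sum_mul, Finset.sum_div]
  simp

variable {E : Type*} [NormedAddCommGroup E] [NormedSpace ℂ E]

/-- Turns a real functional of the series into a sum of inner products with the Gaussian
coefficients. -/
theorem strongDual_complex_smul (L : StrongDual ℝ E) (z : ℂ) (x : E) :
    L (z • x) = inner ℝ (⟨L x, L (Complex.I • x)⟩ : ℂ) z := by
  have h : z • x = z.re • x + z.im • (Complex.I • x) := by
    conv_lhs => rw [← Complex.re_add_im z]
    rw [add_smul, mul_smul]
    rfl
  rw [h, map_add, map_smul, map_smul, Complex.inner]
  simp

/-- Multiplication by the imaginary unit as a real linear map. -/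
noncomputable def mulI (E : Type*) [NormedAddCommGroup E] [NormedSpace ℂ E] : E →L[ℝ] E :=
  (Complex.I • ContinuousLinearMap.id ℂ E).restrictScalars ℝ

@[simp]
theorem mulI_apply (x : E) : mulI E x = Complex.I • x := rfl

variable {ψ : ℕ → ℕ → E} {C : ℝ}

/-- Duality: feeding the values `L (ψ n k)` back in as coefficients makes the sum of squares a
single value of `L`, to which the block estimate applies. -/
theorem sum_sq_strongDual_le
    (hψ : ∀ (n : ℕ) (c : ℕ → ℂ) (M : ℝ), (∀ k < 2 ^ n, ‖c k‖ ≤ M) →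
      ‖∑ k ∈ Finset.range (2 ^ n), c k • ψ n k‖ ≤ C * √2⁻¹ ^ n * M)
    (L : StrongDual ℝ E) (n : ℕ) :
    ∑ k ∈ Finset.range (2 ^ n), L (ψ n k) ^ 2 ≤ (‖L‖ * C) ^ 2 * 2⁻¹ ^ n := by
  have h1 (k : ℕ) (hk : k < 2 ^ n) : ‖ψ n k‖ ≤ C * √2⁻¹ ^ n := by
    -- A unit coefficient vector recovers the norm of a single basis element.
    have := hψ n (Pi.single k 1) 1 (fun j _ ↦ by
      by_cases h : j = k
      · subst h; simp
      · simp [h])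
    rw [Finset.sum_eq_single_of_mem k (Finset.mem_range.2 hk) (fun j _ hj ↦ by simp [hj])] at this
    simpa using this
  have h2 (k : ℕ) (hk : k < 2 ^ n) : ‖((L (ψ n k) : ℝ) : ℂ)‖ ≤ ‖L‖ * (C * √2⁻¹ ^ n) := by
    rw [Complex.norm_real]
    exact (L.le_opNorm _).trans (by gcongr; exact h1 k hk)
  calc ∑ k ∈ Finset.range (2 ^ n), L (ψ n k) ^ 2
      = L (∑ k ∈ Finset.range (2 ^ n), ((L (ψ n k) : ℝ) : ℂ) • ψ n k) := by
        rw [map_sum]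
        refine Finset.sum_congr rfl fun k _ ↦ ?_
        rw [show ((L (ψ n k) : ℝ) : ℂ) • ψ n k = L (ψ n k) • ψ n k from rfl, map_smul, sq,
          smul_eq_mul]
    _ ≤ ‖L‖ * (C * √2⁻¹ ^ n * (‖L‖ * (C * √2⁻¹ ^ n))) :=
        (le_abs_self _).trans ((L.le_opNorm _).trans (by gcongr; exact hψ n _ _ h2))
    _ = (‖L‖ * C) ^ 2 * (√2⁻¹ * √2⁻¹) ^ n := by rw [mul_pow √2⁻¹]; ring
    _ = _ := by rw [Real.mul_self_sqrt (by norm_num)]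

/-- The variance of `L` under the law of the Gaussian series with coefficients `ψ`. -/
noncomputable def seriesVar (ψ : ℕ → ℕ → E) (L : StrongDual ℝ E) : ℝ :=
  ∑' n, ∑ k ∈ Finset.range (2 ^ n), (L (ψ n k) ^ 2 + L (Complex.I • ψ n k) ^ 2)

theorem hasSum_seriesVar
    (hψ : ∀ (n : ℕ) (c : ℕ → ℂ) (M : ℝ), (∀ k < 2 ^ n, ‖c k‖ ≤ M) →
      ‖∑ k ∈ Finset.range (2 ^ n), c k • ψ n k‖ ≤ C * √2⁻¹ ^ n * M)
    (L : StrongDual ℝ E) :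
    HasSum (fun n ↦ ∑ k ∈ Finset.range (2 ^ n), (L (ψ n k) ^ 2 + L (Complex.I • ψ n k) ^ 2))
      (seriesVar ψ L) := by
  refine Summable.hasSum (Summable.of_nonneg_of_le (fun n ↦ by positivity) (fun n ↦ ?_)
    ((summable_geometric_of_lt_one (r := 2⁻¹) (by norm_num) (by norm_num)).mul_left
      ((‖L‖ * C) ^ 2 + (‖L.comp (mulI E)‖ * C) ^ 2)))
  rw [Finset.sum_add_distrib, add_mul]
  exact add_le_add (sum_sq_strongDual_le hψ L n) (sum_sq_strongDual_le hψ (L.comp (mulI E)) n)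

theorem lintegral_enorm_pow_four_lt_top :
    ∫⁻ z, ‖z‖ₑ ^ 4 ∂(stdGaussian ℂ) < ⊤ := by
  have : MemLp id 4 (stdGaussian ℂ) := IsGaussian.memLp_id _ 4 (by simp)
  have := lintegral_rpow_enorm_lt_top_of_eLpNorm_lt_top (by simp) (by simp) this.2
  simpa using this

/-- Lets a sum of fourth powers control the maximum of the `2 ^ n` coefficients of a level; second
moments would be too weak to beat the `2 ^ n` terms. -/
theorem le_add_pow_four_mul {a x : ℝ} (ha : 0 < a) (hx : 0 ≤ x) : x ≤ a⁻¹ + x ^ 4 * a ^ 3 := by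
  rcases le_total x a⁻¹ with h | h
  · have : 0 ≤ x ^ 4 * a ^ 3 := by positivity
    linarith
  · have h1 : 1 ≤ x * a := by rwa [← inv_le_iff_one_le_mul₀ ha]
    calc x = x * 1 ^ 3 := by ring
      _ ≤ x * (x * a) ^ 3 := by gcongr
      _ = x ^ 4 * a ^ 3 := by ring
      _ ≤ _ := by have : 0 < a⁻¹ := by positivity
                  linarith

theorem ae_summable_weighted_sum_norm_pow_four {a : ℝ} (ha : 0 < a) (ha1 : 2 * a < 1) :
    ∀ᵐ ω ∂(Measure.infinitePi fun _ : (_ : ℕ) × ℕ ↦ stdGaussian ℂ),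
      Summable fun n ↦ a ^ n * ∑ k ∈ Finset.range (2 ^ n), ‖ω ⟨n, k⟩‖ ^ 4 := by
  have hfin : ∫⁻ ω, ∑' n : ℕ, ENNReal.ofReal (a ^ n) *
      ∑ k ∈ Finset.range (2 ^ n), ‖ω ⟨n, k⟩‖ₑ ^ 4
      ∂(Measure.infinitePi fun _ : (_ : ℕ) × ℕ ↦ stdGaussian ℂ) ≠ ⊤ := by
    rw [lintegral_tsum (fun n ↦ Measurable.aemeasurable (by fun_prop))]
    have h (n : ℕ) : ∫⁻ ω, ENNReal.ofReal (a ^ n) *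
        ∑ k ∈ Finset.range (2 ^ n), ‖ω ⟨n, k⟩‖ₑ ^ 4
        ∂(Measure.infinitePi fun _ : (_ : ℕ) × ℕ ↦ stdGaussian ℂ) =
        ENNReal.ofReal ((2 * a) ^ n) * ∫⁻ z, ‖z‖ₑ ^ 4 ∂(stdGaussian ℂ) := by
      rw [lintegral_const_mul _ (by fun_prop), lintegral_finsetSum _ (fun k _ ↦ by fun_prop)]
      have (k : ℕ) := (measurePreserving_eval_infinitePi (fun _ : (_ : ℕ) × ℕ ↦ stdGaussian ℂ)
        ⟨n, k⟩).lintegral_comp (f := fun z ↦ ‖z‖ₑ ^ 4) (by fun_prop)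
      simp only [Function.eval] at this
      simp_rw [this]
      rw [Finset.sum_const, Finset.card_range, nsmul_eq_mul, mul_pow, mul_comm (2 ^ n),
        ENNReal.ofReal_mul (by positivity), mul_assoc]
      congr
      norm_num [ENNReal.ofReal_pow]
    simp_rw [h, ENNReal.tsum_mul_right]
    refine ENNReal.mul_ne_top ?_ lintegral_enorm_pow_four_lt_top.ne
    exact (summable_geometric_of_lt_one (by positivity) ha1).tsum_ofReal_ne_top
  filter_upwards [ae_lt_top (by fun_prop) hfin] with ω hω
  have := ENNReal.summable_toReal hω.ne
  refine this.congr fun n ↦ ?_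
  rw [ENNReal.toReal_mul, ENNReal.toReal_ofReal (by positivity),
    ENNReal.toReal_sum (fun k _ ↦ by simp)]
  simp

/-- The block of level `n` of the Gaussian series with coefficients `ψ`. -/
noncomputable def seriesBlock (ψ : ℕ → ℕ → E) (n : ℕ) (ω : (_ : ℕ) × ℕ → ℂ) : E :=
  ∑ k ∈ Finset.range (2 ^ n), ω ⟨n, k⟩ • ψ n k

theorem ae_summable_seriesBlock [CompleteSpace E]
    (hψ : ∀ (n : ℕ) (c : ℕ → ℂ) (M : ℝ), (∀ k < 2 ^ n, ‖c k‖ ≤ M) →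
      ‖∑ k ∈ Finset.range (2 ^ n), c k • ψ n k‖ ≤ C * √2⁻¹ ^ n * M) :
    ∀ᵐ ω ∂(Measure.infinitePi fun _ : (_ : ℕ) × ℕ ↦ stdGaussian ℂ),
      Summable fun n ↦ seriesBlock ψ n ω := by
  -- With `b ^ 4 = 1/2`, level `n` is bounded by `C * (b ^ n + b ^ (5 * n) * S)`, where `S` is the
  -- sum of fourth powers. Its mean is of order `2 ^ n`, and `2 * b ^ 5 = b < 1`.
  set b : ℝ := √(√2⁻¹) with hb
  have hb0 : 0 < b := by positivity
  have hb2 : b ^ 2 = √2⁻¹ := Real.sq_sqrt (by positivity)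
  have hb4 : b ^ 4 = 2⁻¹ := by
    rw [show b ^ 4 = (b ^ 2) ^ 2 by ring, hb2, Real.sq_sqrt (by norm_num)]
  have hb1 : b < 1 := by
    by_contra h
    have : 1 ≤ b ^ 4 := one_le_pow₀ (not_lt.1 h)
    rw [hb4] at this
    norm_num at this
  filter_upwards [ae_summable_weighted_sum_norm_pow_four (a := b ^ 5) (by positivity)
    (by rw [pow_succ, hb4]; linarith)] with ω hω
  refine Summable.of_norm_bounded (((summable_geometric_of_lt_one hb0.le hb1).add hω).mul_left C)
    fun n ↦ ?_
  refine (hψ n _ ((b ^ n)⁻¹ + (∑ k ∈ Finset.range (2 ^ n), ‖ω ⟨n, k⟩‖ ^ 4) * (b ^ n) ^ 3)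
    fun k hk ↦ (le_add_pow_four_mul (pow_pos hb0 n) (norm_nonneg _)).trans ?_).trans_eq ?_
  · gcongr
    exact Finset.single_le_sum (f := fun k ↦ ‖ω ⟨n, k⟩‖ ^ 4) (fun _ _ ↦ by positivity)
      (Finset.mem_range.2 hk)
  · rw [← hb2, show (b ^ 2) ^ n = b ^ n * b ^ n by ring, show (b ^ 5) ^ n = (b ^ n) ^ 5 by ring]
    field_simp

/-- `Q` is the law of the Gaussian series with coefficients `ψ`. -/
def IsSeriesLaw [MeasurableSpace E] (ψ : ℕ → ℕ → E) (Q : Measure E) : Prop :=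
  ∀ L : StrongDual ℝ E, Q.map L = gaussianReal 0 (seriesVar ψ L).toNNReal

theorem exists_isSeriesLaw [CompleteSpace E] [SecondCountableTopology E]
    [MeasurableSpace E] [BorelSpace E]
    (hψ : ∀ (n : ℕ) (c : ℕ → ℂ) (M : ℝ), (∀ k < 2 ^ n, ‖c k‖ ≤ M) →
      ‖∑ k ∈ Finset.range (2 ^ n), c k • ψ n k‖ ≤ C * √2⁻¹ ^ n * M) :
    ∃ Q : Measure E, IsProbabilityMeasure Q ∧ IsSeriesLaw ψ Q := by
  set P := Measure.infinitePi fun _ : (_ : ℕ) × ℕ ↦ stdGaussian ℂ with hP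
  set S : ℕ → ((_ : ℕ) × ℕ → ℂ) → E := fun N ω ↦ ∑ n ∈ Finset.range N, seriesBlock ψ n ω with hS
  have hSm (N : ℕ) : Measurable (S N) := by
    unfold S seriesBlock
    fun_prop
  obtain ⟨Z, hZm, hZ⟩ := measurable_limit_of_tendsto_metrizable_ae (μ := P) (f := S) (L := atTop)
    (fun N ↦ (hSm N).aemeasurable) (by
      filter_upwards [ae_summable_seriesBlock hψ] with ω hω
      exact ⟨_, hω.hasSum.tendsto_sum_nat⟩)
  refine ⟨P.map Z, Measure.isProbabilityMeasure_map hZm.aemeasurable, fun L ↦ ?_⟩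
  have hlaw (N : ℕ) : P.map (fun ω ↦ L (S N ω)) = gaussianReal 0 (∑ n ∈ Finset.range N,
      ∑ k ∈ Finset.range (2 ^ n), (L (ψ n k) ^ 2 + L (Complex.I • ψ n k) ^ 2)).toNNReal := by
    have h := map_sum_inner_infinitePi_stdGaussian
      ((Finset.range N).sigma fun n ↦ Finset.range (2 ^ n))
      (fun p ↦ ⟨L (ψ p.1 p.2), L (Complex.I • ψ p.1 p.2)⟩)
    simp_rw [Finset.sum_sigma, ← strongDual_complex_smul, ← map_sum] at h
    refine h.trans ?_
    congr 1
    ext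
    rw [Real.coe_toNNReal _ (by positivity)]
    push_cast
    simp_rw [Complex.sq_norm, Complex.normSq_apply, sq]
  -- Characteristic functions of the partial sums converge both to that of the limit, by dominated
  -- convergence, and to the Gaussian one, by convergence of the variances.
  apply Measure.ext_of_charFun
  ext t
  have h1 : Tendsto (fun N ↦ charFun (P.map fun ω ↦ L (S N ω)) t) atTop
      (𝓝 (charFun ((P.map Z).map L) t)) := by
    rw [Measure.map_map (by fun_prop) hZm]
    simp_rw [charFun_apply_real]
    rw [integral_map (by fun_prop) (by fun_prop)]
    simp_rw [fun N ↦ integral_map (μ := P) (φ := fun ω ↦ L (S N ω))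
      (f := fun x : ℝ ↦ Complex.exp (t * x * Complex.I))
      (by have := hSm N; fun_prop) (by fun_prop)]
    refine tendsto_integral_of_dominated_convergence (fun _ ↦ 1)
      (fun N ↦ by have := hSm N; fun_prop) (by fun_prop) (fun N ↦ ?_) ?_
    · refine ae_of_all _ fun ω ↦ ?_
      rw [← Complex.ofReal_mul, Complex.norm_exp_ofReal_mul_I]
    · filter_upwards [hZ] with ω hω
      have : Continuous fun x ↦ Complex.exp (t * (L x : ℝ) * Complex.I) := by fun_prop
      exact (this.tendsto _).comp hω
  refine tendsto_nhds_unique h1 ?_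
  simp_rw [hlaw, charFun_gaussianReal]
  have h2 := (hasSum_seriesVar hψ L).tendsto_sum_nat
  have h3 : Continuous fun v : ℝ ↦
      Complex.exp (t * (0 : ℝ) * Complex.I - (v.toNNReal : ℝ) * t ^ 2 / 2) := by fun_prop
  exact (h3.tendsto _).comp h2

end GaussianSeries

/-! ### Covariances and properness from the one-dimensional laws -/

section GaussianMeasure

open Filter Topology

variable {E : Type*} [NormedAddCommGroup E] [NormedSpace ℂ E]

theorem seriesVar_nonneg (ψ : ℕ → ℕ → E) (L : StrongDual ℝ E) : 0 ≤ seriesVar ψ L :=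
  tsum_nonneg fun _ ↦ by positivity

theorem seriesVar_comp_mulI (ψ : ℕ → ℕ → E) (L : StrongDual ℝ E) :
    seriesVar ψ (L.comp (mulI E)) = seriesVar ψ L := by
  refine tsum_congr fun n ↦ Finset.sum_congr rfl fun k _ ↦ ?_
  simp [smul_smul, add_comm]

variable [MeasurableSpace E] [BorelSpace E] {ψ : ℕ → ℕ → E} {Q : Measure E}

theorem isGaussian_of_map_eq_seriesVar
    (hQ : IsSeriesLaw ψ Q) :
    IsGaussian Q :=
  isGaussian_of_map_eq_gaussianReal fun L ↦ ⟨0, _, hQ L⟩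

theorem integral_strongDual_eq_zero
    (hQ : IsSeriesLaw ψ Q)
    (L : StrongDual ℝ E) : ∫ x, L x ∂Q = 0 := by
  have := integral_map (μ := Q) (φ := L) (f := fun x : ℝ ↦ x) (by fun_prop) (by fun_prop)
  rw [← this, hQ, integral_id_gaussianReal]

theorem integral_strongDual_comp_eq_zero (hQ : IsSeriesLaw ψ Q) (f : StrongDual ℂ E)
    (l : StrongDual ℝ ℂ) : ∫ x, l (f x) ∂Q = 0 :=
  integral_strongDual_eq_zero hQ (l.comp (f.restrictScalars ℝ))

theorem variance_strongDual_eq_seriesVar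
    (hQ : IsSeriesLaw ψ Q)
    (L : StrongDual ℝ E) : Var[L; Q] = seriesVar ψ L := by
  rw [← variance_id_map (by fun_prop), hQ, variance_id_gaussianReal,
    Real.coe_toNNReal _ (seriesVar_nonneg ψ L)]

theorem memLp_two_strongDual_comp (hQ : IsSeriesLaw ψ Q) (f : StrongDual ℂ E)
    (l : StrongDual ℝ ℂ) : MemLp (fun x ↦ l (f x)) 2 Q :=
  have := isGaussian_of_map_eq_seriesVar hQ
  IsGaussian.memLp_dual Q (l.comp (f.restrictScalars ℝ)) 2 (by simp)

theorem hasGaussianLaw_pi_strongDual {ι : Type*} (hQ : IsSeriesLaw ψ Q)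
    (f : ι → StrongDual ℂ E) [Finite ι] : HasGaussianLaw (fun x i ↦ f i x) Q :=
  have := isGaussian_of_map_eq_seriesVar hQ
  (IsGaussian.hasGaussianLaw_id (μ := Q)).map_of_measurable
    (ContinuousLinearMap.pi fun i ↦ (f i).restrictScalars ℝ) (by fun_prop)

theorem covariance_strongDual_eq
    (hQ : IsSeriesLaw ψ Q)
    (L M : StrongDual ℝ E) :
    cov[L, M; Q] = (seriesVar ψ (L + M) - seriesVar ψ L - seriesVar ψ M) / 2 := by
  have := isGaussian_of_map_eq_seriesVar hQ
  have h := variance_add (IsGaussian.memLp_dual Q L 2 (by simp))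
    (IsGaussian.memLp_dual Q M 2 (by simp))
  rw [← variance_strongDual_eq_seriesVar hQ, ← variance_strongDual_eq_seriesVar hQ L,
    ← variance_strongDual_eq_seriesVar hQ M, FunLike.coe_add, h]
  ring

theorem strongDual_complex_apply_of_im_eq_zero (l : StrongDual ℝ ℂ) {z : ℂ} (hz : z.im = 0) :
    l z = z.re * l 1 ∧ l (Complex.I * z) = z.re * l Complex.I := by
  have h : z = (z.re : ℂ) := Complex.ext rfl (by simpa using hz)
  have h1 : z = z.re • (1 : ℂ) := by simp [← h]
  have h2 : Complex.I * z = z.re • Complex.I := by rw [h]; simp [mul_comm]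
  constructor
  · conv_lhs => rw [h1, map_smul, smul_eq_mul]
  · rw [h2, map_smul, smul_eq_mul]

/-- Polarisation of `seriesVar`, done on partial sums. Since `f` and `g` are real on the basis, the
directions `l`, `m` split off as their Euclidean inner product. -/
theorem covariance_strongDual_comp {C : ℝ}
    (hψ : ∀ (n : ℕ) (c : ℕ → ℂ) (M : ℝ), (∀ k < 2 ^ n, ‖c k‖ ≤ M) →
      ‖∑ k ∈ Finset.range (2 ^ n), c k • ψ n k‖ ≤ C * √2⁻¹ ^ n * M)
    (hQ : IsSeriesLaw ψ Q)
    (f g : StrongDual ℂ E) (hf : ∀ n k, (f (ψ n k)).im = 0) (hg : ∀ n k, (g (ψ n k)).im = 0)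
    {c : ℝ} (hc : Tendsto (fun N ↦ ∑ n ∈ Finset.range N, ∑ k ∈ Finset.range (2 ^ n),
      (f (ψ n k)).re * (g (ψ n k)).re) atTop (𝓝 c)) (l m : StrongDual ℝ ℂ) :
    cov[fun x ↦ l (f x), fun x ↦ m (g x); Q] = (l 1 * m 1 + l Complex.I * m Complex.I) * c := by
  have h := covariance_strongDual_eq hQ (l.comp (f.restrictScalars ℝ))
    (m.comp (g.restrictScalars ℝ))
  refine Eq.trans h ?_
  have h2 := (hasSum_seriesVar hψ (l.comp (f.restrictScalars ℝ))).tendsto_sum_nat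
  have h3 := (hasSum_seriesVar hψ (m.comp (g.restrictScalars ℝ))).tendsto_sum_nat
  have h1 := (hasSum_seriesVar hψ (l.comp (f.restrictScalars ℝ) +
    m.comp (g.restrictScalars ℝ))).tendsto_sum_nat
  refine tendsto_nhds_unique (((h1.sub h2).sub h3).div_const 2) ?_
  refine (hc.const_mul (l 1 * m 1 + l Complex.I * m Complex.I)).congr fun N ↦ ?_
  simp_rw [Finset.mul_sum, ← Finset.sum_sub_distrib, Finset.sum_div]
  refine Finset.sum_congr rfl fun n _ ↦ Finset.sum_congr rfl fun k _ ↦ ?_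
  simp only [add_apply, ContinuousLinearMap.comp_apply,
    ContinuousLinearMap.coe_restrictScalars', map_smul, smul_eq_mul,
    (strongDual_complex_apply_of_im_eq_zero l (hf n k)).1,
    (strongDual_complex_apply_of_im_eq_zero l (hf n k)).2,
    (strongDual_complex_apply_of_im_eq_zero m (hg n k)).1,
    (strongDual_complex_apply_of_im_eq_zero m (hg n k)).2]
  ring

variable [CompleteSpace E] [SecondCountableTopology E]

theorem map_mulI_eq_self
    (hQ : IsSeriesLaw ψ Q) :
    Q.map (mulI E) = Q := by
  have := isGaussian_of_map_eq_seriesVar hQ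
  apply Measure.ext_of_charFunDual
  ext L
  rw [charFunDual_map, charFunDual_eq_charFun_map_one, charFunDual_eq_charFun_map_one, hQ, hQ,
    seriesVar_comp_mulI]

/-- Invariance of `Q` under `x ↦ I • x` gives `E f = I * E f` and `E (f * g) = -E (f * g)`, so both
vanish. -/
theorem isProperGaussianField_id
    (hQ : IsSeriesLaw ψ Q) :
    IsProperGaussianField (fun x : E ↦ x) Q := by
  have := isGaussian_of_map_eq_seriesVar hQ
  have hg (f : StrongDual ℂ E) : HasGaussianLaw (fun x ↦ f x) Q :=
    (IsGaussian.hasGaussianLaw_id (μ := Q)).map (f.restrictScalars ℝ)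
  have hm : MeasurePreserving (mulI E) Q Q := ⟨by fun_prop, map_mulI_eq_self hQ⟩
  have hI (F : E → ℂ) (hF : Continuous F) : ∫ x, F (Complex.I • x) ∂Q = ∫ x, F x ∂Q := by
    conv_rhs => rw [← hm.map_eq]
    rw [integral_map (by fun_prop) (by fun_prop)]
    rfl
  have h0 (f : StrongDual ℂ E) : ∫ x, f x ∂Q = 0 := by
    have h := hI f f.continuous
    simp_rw [map_smul, smul_eq_mul] at h
    rw [integral_const_mul] at h
    have h' : (Complex.I - 1) * ∫ x, f x ∂Q = 0 := by rw [sub_mul, h]; ring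
    refine (mul_eq_zero.1 h').resolve_left fun h'' ↦ ?_
    simpa using congrArg Complex.im h''
  refine ⟨measurable_id, hg, fun f ↦ (hg f).memLp_two, h0, fun f g ↦ ?_⟩
  unfold pCov
  simp_rw [h0, sub_zero]
  have h := hI (fun x ↦ f x * g x) (by fun_prop)
  simp_rw [map_smul, smul_eq_mul] at h
  have h2 (x : E) : Complex.I * f x * (Complex.I * g x) = -(f x * g x) := by
    linear_combination (f x * g x) * Complex.I_mul_I
  simp_rw [h2, integral_neg] at h
  exact self_eq_neg.1 h.symm

end GaussianMeasure

theorem IsProperGaussianField.isProperGaussian {Ω E : Type*} {mΩ : MeasurableSpace Ω}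
    [NormedAddCommGroup E] [NormedSpace ℂ E] [MeasurableSpace E] [BorelSpace E] {X : Ω → E}
    {P : Measure Ω} (hX : IsProperGaussianField X P) (f : StrongDual ℂ E) :
    IsProperGaussian (fun ω ↦ f (X ω)) P :=
  ⟨hX.gaussian f, f.measurable.comp hX.measurable, hX.finite_variance f, hX.mean_eq_zero f,
    hX.pCov_eq_zero f f⟩

/-! ### Brownian motion and existence of Wiener measure -/

section WienerMeasure

open Filter Topology

variable {T : ℝ}

section BrownianMotion

variable {E : Type*} [NormedAddCommGroup E] [NormedSpace ℂ E] [MeasurableSpace E] [BorelSpace E]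
  {ψ : ℕ → ℕ → E} {Q : Measure E} {C : ℝ} {d : Icc (0 : ℝ) T → StrongDual ℂ E}

theorem covariance_increments
    (hψ : ∀ (n : ℕ) (c : ℕ → ℂ) (M : ℝ), (∀ k < 2 ^ n, ‖c k‖ ≤ M) →
      ‖∑ k ∈ Finset.range (2 ^ n), c k • ψ n k‖ ≤ C * √2⁻¹ ^ n * M)
    (hQ : IsSeriesLaw ψ Q) (him : ∀ t n k, (d t (ψ n k)).im = 0)
    (hd : ∀ s t : Icc (0 : ℝ) T, Tendsto (fun N ↦ ∑ n ∈ Finset.range N,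
      ∑ k ∈ Finset.range (2 ^ n), (d s (ψ n k)).re * (d t (ψ n k)).re) atTop
        (𝓝 (min (s : ℝ) t / 2)))
    (s t s' t' : Icc (0 : ℝ) T) (l m : StrongDual ℝ ℂ) :
    cov[fun z ↦ l (d t z - d s z), fun z ↦ m (d t' z - d s' z); Q] =
      (l 1 * m 1 + l Complex.I * m Complex.I) * ((min (t : ℝ) t' - min (t : ℝ) s' -
        min (s : ℝ) t' + min (s : ℝ) s') / 2) := by
  refine covariance_strongDual_comp hψ hQ (d t - d s) (d t' - d s')
    (fun n k ↦ by simp [him]) (fun n k ↦ by simp [him]) ?_ l m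
  have h := (((hd t t').sub (hd t s')).sub (hd s t')).add (hd s s')
  convert! h using 2
  · simp_rw [← Finset.sum_sub_distrib, ← Finset.sum_add_distrib]
    refine Finset.sum_congr rfl fun n _ ↦ Finset.sum_congr rfl fun k _ ↦ ?_
    simp only [sub_apply, Complex.sub_re]
    ring
  · ring

variable [CompleteSpace E] [SecondCountableTopology E]

theorem isComplexBrownianMotion_of_isSeriesLaw
    (hψ : ∀ (n : ℕ) (c : ℕ → ℂ) (M : ℝ), (∀ k < 2 ^ n, ‖c k‖ ≤ M) →
      ‖∑ k ∈ Finset.range (2 ^ n), c k • ψ n k‖ ≤ C * √2⁻¹ ^ n * M)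
    (hQ : IsSeriesLaw ψ Q) (him : ∀ t n k, (d t (ψ n k)).im = 0)
    (hd : ∀ s t : Icc (0 : ℝ) T, Tendsto (fun N ↦ ∑ n ∈ Finset.range N,
      ∑ k ∈ Finset.range (2 ^ n), (d s (ψ n k)).re * (d t (ψ n k)).re) atTop
        (𝓝 (min (s : ℝ) t / 2)))
    (hzero : ∀ x, ∀ t : Icc (0 : ℝ) T, (t : ℝ) = 0 → d t x = 0)
    (hcont : ∀ x, Continuous fun t ↦ d t x) :
    IsComplexBrownianMotion (fun (t : Icc (0 : ℝ) T) z ↦ d t z) Q := by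
  have hField := isProperGaussianField_id hQ
  refine ⟨fun t ↦ (d t).measurable, ae_of_all _ hzero, ae_of_all _ hcont, fun n t ht ↦ ?_,
    fun s t _ ↦ hField.isProperGaussian (d t - d s), fun s t hst ↦ ?_⟩
  · refine HasGaussianLaw.iIndepFun_of_covariance_strongDual ?_ fun i j hij l m ↦ ?_
    · exact hasGaussianLaw_pi_strongDual hQ fun i : Fin n ↦ d (t i.succ) - d (t i.castSucc)
    · refine (covariance_increments hψ hQ him hd _ _ _ _ l m).trans ?_
      have hm {a b : Fin (n + 1)} (h : a ≤ b) : (t a : ℝ) ≤ t b := ht h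
      rcases lt_or_gt_of_ne hij with h | h
      -- For non-overlapping intervals the earlier endpoint is the minimum in all four terms, so
      -- they cancel in pairs.
      · have h1 : i.succ ≤ j.castSucc := h
        have h2 : i.castSucc ≤ j.castSucc := h.le
        have h3 : i.succ ≤ j.succ := h1.trans (Fin.castSucc_lt_succ).le
        have h4 : i.castSucc ≤ j.succ := h2.trans (Fin.castSucc_lt_succ).le
        rw [min_eq_left (hm h1), min_eq_left (hm h2), min_eq_left (hm h3), min_eq_left (hm h4)]
        ring
      · have h1 : j.succ ≤ i.castSucc := h
        have h2 : j.castSucc ≤ i.castSucc := h.le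
        have h3 : j.succ ≤ i.succ := h1.trans (Fin.castSucc_lt_succ).le
        have h4 : j.castSucc ≤ i.succ := h2.trans (Fin.castSucc_lt_succ).le
        rw [min_eq_right (hm h1), min_eq_right (hm h2), min_eq_right (hm h3), min_eq_right (hm h4)]
        ring
  · have h0 (l : StrongDual ℝ ℂ) : ∫ z, l (d t z - d s z) ∂Q = 0 :=
      integral_strongDual_comp_eq_zero hQ (d t - d s) l
    have hL (l : StrongDual ℝ ℂ) : MemLp (fun z ↦ l (d t z - d s z)) 2 Q :=
      memLp_two_strongDual_comp hQ (d t - d s) l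
    have h2 (l : StrongDual ℝ ℂ) : ∫ z, l (d t z - d s z) ^ 2 ∂Q =
        (l 1 ^ 2 + l Complex.I ^ 2) * ((t - s) / 2) := by
      rw [← variance_of_integral_eq_zero (hL l).aemeasurable (h0 l), ← covariance_self
        (hL l).aemeasurable, covariance_increments hψ hQ him hd]
      have : (s : ℝ) ≤ t := hst
      simp only [min_self, min_eq_left this, min_eq_right this]
      ring
    have hmean : ∫ z, (d t z - d s z) ∂Q = 0 := hField.mean_eq_zero (d t - d s)
    unfold cVar
    simp_rw [hmean, sub_zero, Complex.sq_norm, Complex.normSq_apply, ← sq]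
    have h3 := h2 Complex.reCLM
    have h4 := h2 Complex.imCLM
    simp only [Complex.reCLM_apply, Complex.imCLM_apply] at h3 h4
    rw [integral_add (by simpa using (hL Complex.reCLM).integrable_sq)
      (by simpa using (hL Complex.imCLM).integrable_sq), h3, h4]
    simp

end BrownianMotion

theorem isClosed_wienerSpace (T : ℝ) : IsClosed (wienerSpace T : Set C(Icc (0 : ℝ) T, ℂ)) := by
  have : (wienerSpace T : Set C(Icc (0 : ℝ) T, ℂ)) =
      ⋂ (t : Icc (0 : ℝ) T) (_ : (t : ℝ) = 0), {z | z t = 0} := by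
    ext z
    simp [wienerSpace]
  rw [this]
  exact isClosed_iInter fun t ↦ isClosed_iInter fun _ ↦
    isClosed_eq (ContinuousMap.evalCLM ℂ t).continuous continuous_const

instance instCompleteSpaceWienerSpace : CompleteSpace (wienerSpace T) :=
  (isClosed_wienerSpace T).completeSpace_coe

/-- Existence of the Wiener measure on `C₀([0, T]; ℂ)`. -/
theorem exists_wienerMeasure (hT : 0 ≤ T) :
    ∃ Q : Measure (wienerSpace T), IsProbabilityMeasure Q ∧
      IsProperGaussianField (fun z : wienerSpace T ↦ z) Q ∧
      IsComplexBrownianMotion (fun (t : Icc (0 : ℝ) T) z ↦ δ t z) Q := by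
  obtain ⟨Q, hQ, hlaw⟩ := exists_isSeriesLaw (C := 1 + T) (ψ := schauder T) (by
    intro n c M h
    exact norm_sum_smul_schauder_le hT n c M h)
  refine ⟨Q, hQ, isProperGaussianField_id hlaw, ?_⟩
  refine isComplexBrownianMotion_of_isSeriesLaw (C := 1 + T) (ψ := schauder T) ?_ hlaw ?_ ?_ ?_ ?_
  · intro n c M h
    exact norm_sum_smul_schauder_le hT n c M h
  · intro t n k
    exact Complex.ofReal_im _
  · intro s t
    exact tendsto_sum_schauder_mul_schauder s t
  · intro z t ht
    exact z.2 t ht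
  · intro z
    exact z.1.continuous

end WienerMeasure

/-! ### Densities of proper complex Gaussians -/

section ComplexGaussianDensity

variable {Ω : Type*} {mΩ : MeasurableSpace Ω} {P : Measure Ω}

theorem map_withDensity_comp {α β : Type*} {mα : MeasurableSpace α} {mβ : MeasurableSpace β}
    {μ : Measure α} {ν : Measure β} {e : α → β} (he : MeasurePreserving e μ ν) {f : β → ℝ≥0∞}
    (hf : Measurable f) : (μ.withDensity (f ∘ e)).map e = ν.withDensity f := by
  ext s hs
  rw [Measure.map_apply he.measurable hs, withDensity_apply _ (he.measurable hs),
    withDensity_apply _ hs, ← he.setLIntegral_comp_preimage hs hf]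
  rfl

/-- The density of the proper complex Gaussian distribution of variance `v`. -/
noncomputable def complexGaussianPDF (v : ℝ) (z : ℂ) : ℝ≥0∞ :=
  ENNReal.ofReal ((Real.pi * v)⁻¹ * Real.exp (-(‖z‖ ^ 2 / v)))

@[fun_prop]
theorem measurable_complexGaussianPDF (v : ℝ) : Measurable (complexGaussianPDF v) := by
  unfold complexGaussianPDF
  fun_prop

theorem gaussianPDF_mul_gaussianPDF {v : ℝ} (hv : 0 < v) (z : ℂ) :
    gaussianPDF 0 (v / 2).toNNReal z.re * gaussianPDF 0 (v / 2).toNNReal z.im =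
      complexGaussianPDF v z := by
  have hpi := Real.pi_pos
  rw [gaussianPDF, gaussianPDF, ← ENNReal.ofReal_mul (gaussianPDFReal_nonneg _ _ _),
    complexGaussianPDF, gaussianPDFReal, gaussianPDFReal, Real.coe_toNNReal _ (by positivity),
    Complex.sq_norm, Complex.normSq_apply]
  congr 1
  rw [mul_mul_mul_comm, ← mul_inv, Real.mul_self_sqrt (by positivity), ← Real.exp_add]
  congr 2
  · field_simp
  · field_simp
    ring

/-- Real and imaginary parts of `E X² = 0` say that the coordinates have equal variance and are
uncorrelated, hence independent; each carries half of `cVar`. -/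
theorem IsProperGaussian.map_eq_withDensity {X : Ω → ℂ} (hX : IsProperGaussian X P)
    (hv : 0 < cVar X P) : P.map X = volume.withDensity (complexGaussianPDF (cVar X P)) := by
  have hP := hX.gaussian.isProbabilityMeasure
  have hXm := hX.proper.measurable
  have hAB : HasGaussianLaw (fun ω ↦ ((X ω).re, (X ω).im)) P :=
    hX.gaussian.map Complex.equivRealProdCLM.toContinuousLinearMap
  have hA := hAB.fst
  have hB := hAB.snd
  have hA2 : Integrable (fun ω ↦ (X ω).re * (X ω).re) P := hA.memLp_two.integrable_mul hA.memLp_two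
  have hB2 : Integrable (fun ω ↦ (X ω).im * (X ω).im) P := hB.memLp_two.integrable_mul hB.memLp_two
  have hABi : Integrable (fun ω ↦ (X ω).re * (X ω).im) P :=
    hA.memLp_two.integrable_mul hB.memLp_two
  have hXX : Integrable (fun ω ↦ X ω * X ω) P :=
    hX.gaussian.memLp_two.integrable_mul hX.gaussian.memLp_two
  have hA0 : ∫ ω, (X ω).re ∂P = 0 := by
    have := Complex.reCLM.integral_comp_comm hX.gaussian.integrable
    simpa [hX.proper.mean_eq_zero] using this
  have hB0 : ∫ ω, (X ω).im ∂P = 0 := by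
    have := Complex.imCLM.integral_comp_comm hX.gaussian.integrable
    simpa [hX.proper.mean_eq_zero] using this
  have hp : ∫ ω, X ω * X ω ∂P = 0 := by
    simpa [pVar, pCov, hX.proper.mean_eq_zero] using hX.proper.pVar_eq_zero
  have hpre : ∫ ω, (X ω).re * (X ω).re ∂P - ∫ ω, (X ω).im * (X ω).im ∂P = 0 := by
    have := Complex.reCLM.integral_comp_comm hXX
    simp only [Complex.reCLM_apply, Complex.mul_re, hp, Complex.zero_re] at this
    rwa [integral_sub hA2 hB2] at this
  have hpim : ∫ ω, (X ω).re * (X ω).im ∂P = 0 := by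
    have := Complex.imCLM.integral_comp_comm hXX
    simp only [Complex.imCLM_apply, Complex.mul_im, hp, Complex.zero_im, mul_comm (X _).im,
      ← two_mul] at this
    rw [integral_const_mul] at this
    linarith
  have hvar : ∫ ω, (X ω).re * (X ω).re ∂P + ∫ ω, (X ω).im * (X ω).im ∂P = cVar X P := by
    rw [cVar, ← integral_add hA2 hB2]
    simp_rw [hX.proper.mean_eq_zero, sub_zero, Complex.sq_norm, Complex.normSq_apply]
  have hvA : Var[fun ω ↦ (X ω).re; P] = cVar X P / 2 := by
    rw [variance_of_integral_eq_zero hA.aemeasurable hA0]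
    simp only [sq]
    linarith
  have hvB : Var[fun ω ↦ (X ω).im; P] = cVar X P / 2 := by
    rw [variance_of_integral_eq_zero hB.aemeasurable hB0]
    simp only [sq]
    linarith
  have hind : IndepFun (fun ω ↦ (X ω).re) (fun ω ↦ (X ω).im) P :=
    hAB.indepFun_of_covariance_eq_zero (by
      rw [covariance_eq_sub hA.memLp_two hB.memLp_two, hA0, zero_mul, sub_zero]
      exact hpim)
  have hne : (cVar X P / 2).toNNReal ≠ 0 := (Real.toNNReal_pos.2 (by positivity)).ne'
  have hlaw : P.map (fun ω ↦ ((X ω).re, (X ω).im)) = volume.withDensity (fun p : ℝ × ℝ ↦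
      gaussianPDF 0 (cVar X P / 2).toNNReal p.1 * gaussianPDF 0 (cVar X P / 2).toNNReal p.2) := by
    rw [(indepFun_iff_map_prod_eq_prod_map_map hA.aemeasurable hB.aemeasurable).1 hind,
      hA.map_eq_gaussianReal, hB.map_eq_gaussianReal, hvA, hvB, hA0, hB0,
      gaussianReal_of_var_ne_zero _ hne, prod_withDensity (measurable_gaussianPDF _ _)
      (measurable_gaussianPDF _ _)]
    rfl
  refine Complex.measurableEquivRealProd.map_measurableEquiv_injective ?_
  rw [Measure.map_map (by fun_prop) hXm]
  refine hlaw.trans ?_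
  rw [← map_withDensity_comp Complex.volume_preserving_equiv_real_prod
    (by have := measurable_gaussianPDF 0 (cVar X P / 2).toNNReal; fun_prop)]
  congr 2
  ext z
  exact gaussianPDF_mul_gaussianPDF hv z

theorem lintegral_fin_prod_eq_prod {n : ℕ} (F : Fin n → ℂ → ℝ≥0∞) (hF : ∀ k, Measurable (F k)) :
    ∫⁻ z : Fin n → ℂ, ∏ k, F k (z k) = ∏ k, ∫⁻ z, F k z := by
  induction n with
  | zero => simp [volume_pi]
  | succ n ih =>
    rw [← ((volume_preserving_piFinSuccAbove (fun _ ↦ ℂ) (0 : Fin (n + 1))).symm).lintegral_comp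
      (by fun_prop)]
    simp only [MeasurableEquiv.piFinSuccAbove, Fin.insertNthEquiv, Fin.prod_univ_succ]
    rw [← ih (fun k ↦ F k.succ) fun k ↦ hF _]
    exact lintegral_prod_mul (μ := (volume : Measure ℂ)) (ν := (volume : Measure (Fin n → ℂ)))
      (hF 0).aemeasurable
      (Measurable.aemeasurable (f := fun z : Fin n → ℂ ↦ ∏ k, F k.succ (z k)) (by fun_prop))

theorem pi_withDensity {n : ℕ} (F : Fin n → ℂ → ℝ≥0∞) (hF : ∀ k, Measurable (F k))
    [∀ k, SigmaFinite ((volume : Measure ℂ).withDensity (F k))] :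
    Measure.pi (fun k ↦ (volume : Measure ℂ).withDensity (F k)) =
      (volume : Measure (Fin n → ℂ)).withDensity (fun z ↦ ∏ k, F k (z k)) := by
  refine Measure.pi_eq fun s hs ↦ ?_
  rw [withDensity_apply _ (MeasurableSet.univ_pi hs), ← lintegral_indicator
    (MeasurableSet.univ_pi hs)]
  have h (k : Fin n) : (volume.withDensity (F k)) (s k) = ∫⁻ z, (s k).indicator (F k) z := by
    rw [withDensity_apply _ (hs k), lintegral_indicator (hs k)]
  simp_rw [h]
  rw [← lintegral_fin_prod_eq_prod _ fun k ↦ (hF k).indicator (hs k)]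
  refine lintegral_congr fun z ↦ ?_
  by_cases hz : z ∈ univ.pi s
  · rw [indicator_of_mem hz]
    exact Finset.prod_congr rfl fun k _ ↦ (indicator_of_mem (hz k (mem_univ k)) _).symm
  · rw [indicator_of_notMem hz]
    simp only [mem_univ_pi, not_forall] at hz
    obtain ⟨k, hk⟩ := hz
    exact (Finset.prod_eq_zero (Finset.mem_univ k) (indicator_of_notMem hk _)).symm

end ComplexGaussianDensity

/-! ### The increment map on `ℂⁿ` -/

section Increments

/-- The increments of the sequence `x₀, x 0, …, x (n - 1)`. -/
def increments {n : ℕ} (x₀ : ℂ) (x : Fin n → ℂ) (k : Fin n) : ℂ :=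
  x k - (Fin.cons x₀ x : Fin (n + 1) → ℂ) k.castSucc

theorem increments_cons {n : ℕ} (x₀ y : ℂ) (x : Fin n → ℂ) :
    increments x₀ (Fin.cons y x : Fin (n + 1) → ℂ) =
      (Fin.cons (y - x₀) (increments y x) : Fin (n + 1) → ℂ) := by
  ext k
  refine Fin.cases ?_ (fun j ↦ ?_) k
  · simp [increments]
  · simp [increments]

theorem increments_injective {n : ℕ} (x₀ : ℂ) :
    Function.Injective (increments x₀ : (Fin n → ℂ) → Fin n → ℂ) := by
  induction n generalizing x₀ with
  | zero => exact fun x y _ ↦ Subsingleton.elim x y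
  | succ n ih =>
    intro x y h
    rw [← Fin.cons_self_tail x, ← Fin.cons_self_tail y, increments_cons, increments_cons,
      Fin.cons_inj] at h
    have h0 := sub_left_inj.1 h.1
    rw [h0] at h
    rw [← Fin.cons_self_tail x, ← Fin.cons_self_tail y, h0, ih _ h.2]

theorem continuous_increments (n : ℕ) :
    Continuous fun p : ℂ × (Fin n → ℂ) ↦ increments p.1 p.2 := by
  refine continuous_pi fun k ↦ ?_
  unfold increments
  refine Continuous.sub (by fun_prop) ?_
  generalize k.castSucc = j
  refine Fin.cases ?_ (fun j ↦ ?_) j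
  · simpa using continuous_fst
  · simp only [Fin.cons_succ]
    fun_prop

theorem measurable_increments {n : ℕ} (x₀ : ℂ) :
    Measurable (increments x₀ : (Fin n → ℂ) → Fin n → ℂ) :=
  ((continuous_increments n).comp (Continuous.prodMk_right x₀)).measurable

/-- Induction by a skew product: a translation in the first coordinate and, over each first value
`y`, the increment map started at `y`. -/
theorem measurePreserving_increments {n : ℕ} (x₀ : ℂ) :
    MeasurePreserving (increments x₀ : (Fin n → ℂ) → Fin n → ℂ) := by
  induction n generalizing x₀ with
  | zero =>
    rw [show (increments x₀ : (Fin 0 → ℂ) → Fin 0 → ℂ) = id from Subsingleton.elim _ _]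
    exact MeasurePreserving.id _
  | succ n ih =>
    have e := volume_preserving_piFinSuccAbove (fun _ ↦ ℂ) (0 : Fin (n + 1))
    have h := MeasurePreserving.skew_product
      (measurePreserving_sub_right (volume : Measure ℂ) x₀) (g := fun y x ↦ increments y x)
      (μc := (volume : Measure (Fin n → ℂ))) (μd := volume)
      (continuous_increments n).measurable (ae_of_all _ fun y ↦ (ih y).map_eq)
    convert (e.symm.comp h).comp e using 1
    ext1 x
    conv_lhs => rw [← Fin.cons_self_tail x, increments_cons]
    simp [MeasurableEquiv.piFinSuccAbove, Fin.insertNthEquiv]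

end Increments

/-! ### Finite-dimensional distributions -/

section FiniteDimensionalDistributions

variable {Ω : Type*} {mΩ : MeasurableSpace Ω} {P : Measure Ω} {T : ℝ}

theorem IsProperGaussian.const_smul {X : Ω → ℂ} (hX : IsProperGaussian X P) (c : ℝ) :
    IsProperGaussian (fun ω ↦ c • X ω) P := by
  have h0 : ∫ ω, c • X ω ∂P = 0 := by
    rw [integral_smul, hX.proper.mean_eq_zero, smul_zero]
  have h1 : ∫ ω, X ω * X ω ∂P = 0 := by
    simpa [pVar, pCov, hX.proper.mean_eq_zero] using hX.proper.pVar_eq_zero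
  refine ⟨hX.gaussian.fun_smul c, hX.proper.measurable.const_smul c,
    hX.proper.finite_variance.const_smul c, h0, ?_⟩
  simp only [pVar, pCov, h0, sub_zero, smul_mul_smul_comm]
  rw [integral_smul, h1, smul_zero]

theorem IsProperGaussian.cVar_const_smul {X : Ω → ℂ} (hX : IsProperGaussian X P) (c : ℝ) :
    cVar (fun ω ↦ c • X ω) P = c ^ 2 * cVar X P := by
  have h0 : ∫ ω, c • X ω ∂P = 0 := by
    rw [integral_smul, hX.proper.mean_eq_zero, smul_zero]
  simp only [cVar, h0, sub_zero, hX.proper.mean_eq_zero, norm_smul, mul_pow, Real.norm_eq_abs,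
    sq_abs]
  rw [integral_const_mul]

theorem prod_complexGaussianPDF {n : ℕ} {v : ℝ} (hv : 0 < v) {τ : Fin n → ℝ} (hτ : ∀ k, 0 < τ k)
    (z : Fin n → ℂ) :
    ∏ k, complexGaussianPDF (v * τ k) (z k) =
      ENNReal.ofReal (∏ k, (Real.pi * v * τ k)⁻¹) *
        ENNReal.ofReal (Real.exp (-(1 / v) * ∑ k, ‖z k‖ ^ 2 / τ k)) := by
  have hpi := Real.pi_pos
  unfold complexGaussianPDF
  have h (k : Fin n) : 0 ≤ (Real.pi * v * τ k)⁻¹ := by have := hτ k; positivity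
  rw [← ENNReal.ofReal_prod_of_nonneg, ← ENNReal.ofReal_mul (Finset.prod_nonneg fun k _ ↦ h k),
    Finset.mul_sum, Real.exp_sum, ← Finset.prod_mul_distrib]
  · congr 1
    refine Finset.prod_congr rfl fun k _ ↦ ?_
    rw [mul_assoc Real.pi]
    congr 2
    have := (hτ k).ne'
    field_simp
  · intro k _
    have := hτ k
    positivity

theorem cons_path_eq {n : ℕ} {x₀ : ℂ} (x : PathsFrom T x₀) {t : Fin (n + 1) → Icc (0 : ℝ) T}
    (ht : (t 0 : ℝ) = 0) (j : Fin (n + 1)) :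
    (Fin.cons x₀ (fun k ↦ x.1 (t k.succ)) : Fin (n + 1) → ℂ) j = x.1 (t j) := by
  refine Fin.cases ?_ (fun j ↦ ?_) j
  · rw [Fin.cons_zero, x.2 _ ht]
  · rw [Fin.cons_succ]

theorem measurable_eval_path {x₀ : ℂ} (t : Icc (0 : ℝ) T) :
    Measurable fun x : PathsFrom T x₀ ↦ x.1 t :=
  (ContinuousMap.evalCLM ℂ t).continuous.measurable.comp measurable_subtype_coe

theorem map_path_eq_withDensity {W : Icc (0 : ℝ) T → Ω → ℂ} (hW : IsComplexBrownianMotion W P)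
    {c : ℝ} (hc : 0 < c) {x₀ : ℂ} {Y : Ω → PathsFrom T x₀} (hY : Measurable Y)
    (hYW : ∀ ω t, (Y ω).1 t = x₀ + c • W t ω) {n : ℕ} {t : Fin (n + 1) → Icc (0 : ℝ) T}
    (ht : StrictMono t) (ht0 : (t 0 : ℝ) = 0) :
    P.map (fun ω (k : Fin n) ↦ (Y ω).1 (t k.succ)) =
      volume.withDensity fun x : Fin n → ℂ ↦
        ∏ k, complexGaussianPDF (c ^ 2 * ((t k.succ : ℝ) - t k.castSucc)) (increments x₀ x k) := by
  have hemb : MeasurableEmbedding (increments x₀ : (Fin n → ℂ) → Fin n → ℂ) :=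
    ((continuous_increments n).comp (Continuous.prodMk_right x₀)).measurableEmbedding
      (increments_injective x₀)
  have hYm : Measurable fun ω (k : Fin n) ↦ (Y ω).1 (t k.succ) :=
    measurable_pi_lambda _ fun k ↦ (measurable_eval_path _).comp hY
  have hinc (ω : Ω) : increments x₀ (fun k : Fin n ↦ (Y ω).1 (t k.succ)) =
      fun k ↦ c • (W (t k.succ) ω - W (t k.castSucc) ω) := by
    ext1 k
    rw [increments, cons_path_eq _ ht0, hYW, hYW, smul_sub]
    ring
  have hpos (k : Fin n) : 0 < (t k.succ : ℝ) - t k.castSucc :=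
    sub_pos.2 (ht (Fin.castSucc_lt_succ))
  have hgauss (k : Fin n) := hW.gaussian_increments _ _ (ht (Fin.castSucc_lt_succ (i := k))).le
  have hlaw (k : Fin n) : P.map (fun ω ↦ c • (W (t k.succ) ω - W (t k.castSucc) ω)) =
      volume.withDensity (complexGaussianPDF (c ^ 2 * ((t k.succ : ℝ) - t k.castSucc))) := by
    have hv : cVar (fun ω ↦ c • (W (t k.succ) ω - W (t k.castSucc) ω)) P =
        c ^ 2 * ((t k.succ : ℝ) - t k.castSucc) := by
      rw [(hgauss k).cVar_const_smul, hW.var_increments _ _ (ht (Fin.castSucc_lt_succ)).le]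
    rw [((hgauss k).const_smul c).map_eq_withDensity, hv]
    rw [hv]
    exact mul_pos (by positivity) (hpos k)
  have hm (k : Fin n) : Measurable fun ω ↦ c • (W (t k.succ) ω - W (t k.castSucc) ω) :=
    ((hW.measurable _).sub (hW.measurable _)).const_smul c
  have hind : iIndepFun (fun (k : Fin n) ω ↦ c • (W (t k.succ) ω - W (t k.castSucc) ω)) P :=
    (hW.indep_increments n t ht.monotone).comp (fun _ z ↦ c • z) fun _ ↦ by fun_prop
  have hprob := hind.isProbabilityMeasure
  have hprob' (k : Fin n) : IsProbabilityMeasure ((volume : Measure ℂ).withDensity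
      (complexGaussianPDF (c ^ 2 * ((t k.succ : ℝ) - t k.castSucc)))) := by
    rw [← hlaw k]
    exact Measure.isProbabilityMeasure_map (hm k).aemeasurable
  -- The two laws are compared after applying the increment map, where independence gives a product;
  -- injectivity then allows pulling back.
  have key : (P.map (fun ω (k : Fin n) ↦ (Y ω).1 (t k.succ))).map (increments x₀) =
      (volume.withDensity fun x : Fin n → ℂ ↦ ∏ k, complexGaussianPDF
        (c ^ 2 * ((t k.succ : ℝ) - t k.castSucc)) (increments x₀ x k)).map (increments x₀) := by
    rw [Measure.map_map (measurable_increments x₀) hYm]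
    have h1 := map_withDensity_comp (measurePreserving_increments (n := n) x₀)
      (f := fun z ↦ ∏ k, complexGaussianPDF (c ^ 2 * ((t k.succ : ℝ) - t k.castSucc)) (z k))
      (by fun_prop)
    refine Eq.trans ?_ h1.symm
    rw [← pi_withDensity _ fun k ↦ by fun_prop]
    simp_rw [← hlaw]
    rw [← (iIndepFun_iff_map_fun_eq_pi_map fun k ↦ (hm k).aemeasurable).1 hind]
    congr 1
    ext1 ω
    exact hinc ω
  rw [← hemb.comap_map (P.map _), key, hemb.comap_map]

/-- The finite-dimensional distributions of a scaled complex Brownian motion. -/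
theorem IsComplexBrownianMotion.hasComplexGaussianFDD {W : Icc (0 : ℝ) T → Ω → ℂ}
    (hW : IsComplexBrownianMotion W P) {c : ℝ} (hc : 0 < c) {x₀ : ℂ} {Y : Ω → PathsFrom T x₀}
    (hY : Measurable Y) (hYW : ∀ ω t, (Y ω).1 t = x₀ + c • W t ω) :
    HasComplexGaussianFDD x₀ (c ^ 2) (P.map Y) := by
  intro n t ht ht0 f hf
  have hpos (k : Fin n) : 0 < (t k.succ : ℝ) - t k.castSucc :=
    sub_pos.2 (ht (Fin.castSucc_lt_succ))
  have hem : Measurable fun (x : PathsFrom T x₀) (k : Fin n) ↦ x.1 (t k.succ) :=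
    measurable_pi_lambda _ fun k ↦ measurable_eval_path _
  have hinc := measurable_increments (n := n) x₀
  have hdens : Measurable fun x : Fin n → ℂ ↦ ∏ k, complexGaussianPDF
      (c ^ 2 * ((t k.succ : ℝ) - t k.castSucc)) (increments x₀ x k) :=
    Finset.measurable_prod _ fun k _ ↦ (measurable_complexGaussianPDF _).comp
      ((measurable_pi_apply k).comp hinc)
  have hf' : Measurable fun x : Fin n → ℂ ↦ (f x : ℝ≥0∞) := hf.coe_nnreal_ennreal
  calc ∫⁻ x, f (fun k ↦ x.1 (t k.succ)) ∂(P.map Y)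
      = ∫⁻ ω, f (fun k ↦ (Y ω).1 (t k.succ)) ∂P := lintegral_map (hf'.comp hem) hY
    _ = ∫⁻ x, f x ∂(P.map fun ω (k : Fin n) ↦ (Y ω).1 (t k.succ)) :=
        (lintegral_map hf' (hem.comp hY)).symm
    _ = _ := by
        rw [map_path_eq_withDensity hW hc hY hYW ht ht0,
          lintegral_withDensity_eq_lintegral_mul _ hdens hf',
          ← lintegral_const_mul' _ _ ENNReal.ofReal_ne_top]
        refine lintegral_congr fun x ↦ ?_
        rw [Pi.mul_apply, prod_complexGaussianPDF (by positivity) hpos, mul_assoc,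
          mul_comm (f x : ℝ≥0∞)]
        rfl

end FiniteDimensionalDistributions

/-! ### Uniqueness of the path measure -/

section Uniqueness

variable {T : ℝ} {x₀ : ℂ} {v : ℝ} {ν ν' : Measure (PathsFrom T x₀)}

theorem HasComplexGaussianFDD.isProbabilityMeasure (hT : 0 ≤ T)
    (h : HasComplexGaussianFDD x₀ v ν) : IsProbabilityMeasure ν := by
  -- The case `n = 0`, `f = 1` of the formula fixes the total mass.
  have := h 0 (fun _ ↦ ⟨0, le_rfl, hT⟩) (fun i j hij ↦ absurd hij (by omega)) rfl (fun _ ↦ 1)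
    measurable_const
  exact ⟨by simpa [volume_pi] using this⟩

theorem HasComplexGaussianFDD.map_eq_map (h : HasComplexGaussianFDD x₀ v ν)
    (h' : HasComplexGaussianFDD x₀ v ν') {n : ℕ} {t : Fin (n + 1) → Icc (0 : ℝ) T}
    (ht : StrictMono t) (ht0 : (t 0 : ℝ) = 0) :
    ν.map (fun x (k : Fin n) ↦ x.1 (t k.succ)) = ν'.map (fun x (k : Fin n) ↦ x.1 (t k.succ)) := by
  have hem : Measurable fun (x : PathsFrom T x₀) (k : Fin n) ↦ x.1 (t k.succ) :=
    measurable_pi_lambda _ fun k ↦ measurable_eval_path _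
  ext s hs
  have hi : Measurable (s.indicator (1 : (Fin n → ℂ) → ℝ≥0)) := measurable_one.indicator hs
  have heq := (h n t ht ht0 _ hi).trans (h' n t ht ht0 _ hi).symm
  have hl (μ : Measure (PathsFrom T x₀)) : μ.map (fun x (k : Fin n) ↦ x.1 (t k.succ)) s =
      ∫⁻ x, (s.indicator (1 : (Fin n → ℂ) → ℝ≥0) (fun k ↦ x.1 (t k.succ)) : ℝ≥0) ∂μ := by
    rw [← lintegral_indicator_one hs, lintegral_map (measurable_one.indicator hs) hem]
    refine lintegral_congr fun x ↦ ?_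
    by_cases hx : (fun k : Fin n ↦ x.1 (t k.succ)) ∈ s <;> simp [hx]
  rw [hl, hl, heq]

theorem HasComplexGaussianFDD.map_restrict_eq (hT : 0 ≤ T) (h : HasComplexGaussianFDD x₀ v ν)
    (h' : HasComplexGaussianFDD x₀ v ν') (I : Finset (Icc (0 : ℝ) T)) :
    ν.map (fun x (s : I) ↦ x.1 s) = ν'.map (fun x (s : I) ↦ x.1 s) := by
  classical
  -- The formula needs increasing times that start at `0`; adding `0` to `I` is harmless, since
  -- every path has the value `x₀` there.
  set z : Icc (0 : ℝ) T := ⟨0, le_rfl, hT⟩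
  obtain ⟨n, hn⟩ : ∃ n, (insert z I).card = n + 1 :=
    Nat.exists_eq_succ_of_ne_zero (Finset.card_ne_zero_of_mem (Finset.mem_insert_self z I))
  set t := (insert z I).orderEmbOfFin hn with ht_def
  have ht0 : (t 0 : ℝ) = 0 := by
    have hz : z ∈ range t := by
      rw [ht_def, Finset.range_orderEmbOfFin]
      exact Finset.mem_insert_self z I
    obtain ⟨j, hj⟩ := hz
    have h1 : t 0 ≤ z := hj ▸ t.monotone (Fin.zero_le j)
    exact le_antisymm h1 (t 0).2.1
  have hI (s : I) : ∃ j, t j = s := by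
    have : (s : Icc (0 : ℝ) T) ∈ range t := by
      rw [ht_def, Finset.range_orderEmbOfFin]
      exact Finset.mem_insert_of_mem s.2
    exact this
  choose j hj using hI
  have hG : Measurable fun (y : Fin n → ℂ) (s : I) ↦ (Fin.cons x₀ y : Fin (n + 1) → ℂ) (j s) := by
    refine measurable_pi_lambda _ fun s ↦ ?_
    refine Fin.cases ?_ (fun i ↦ ?_) (j s)
    · simp
    · simpa using measurable_pi_apply i
  have hem : Measurable fun (x : PathsFrom T x₀) (k : Fin n) ↦ x.1 (t k.succ) :=
    measurable_pi_lambda _ fun k ↦ measurable_eval_path _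
  have hcomp : (fun (x : PathsFrom T x₀) (s : I) ↦ x.1 s) =
      (fun (y : Fin n → ℂ) (s : I) ↦ (Fin.cons x₀ y : Fin (n + 1) → ℂ) (j s)) ∘
        fun x k ↦ x.1 (t k.succ) := by
    ext x s
    simp only [Function.comp_apply]
    rw [cons_path_eq x ht0, hj]
  rw [hcomp, ← Measure.map_map hG hem, ← Measure.map_map hG hem,
    h.map_eq_map h' t.strictMono ht0]

theorem isClosed_pathsFrom (T : ℝ) (x₀ : ℂ) :
    IsClosed {x : C(Icc (0 : ℝ) T, ℂ) | ∀ t : Icc (0 : ℝ) T, (t : ℝ) = 0 → x t = x₀} := by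
  simp only [ofPred_forall]
  exact isClosed_iInter fun t ↦ isClosed_iInter fun _ ↦
    isClosed_eq (ContinuousMap.evalCLM ℂ t).continuous continuous_const

/-- A path is determined by its values in a countable dense set, in a measurable way. -/
theorem measurableEmbedding_pathsFrom (T : ℝ) (x₀ : ℂ) {D : Set (Icc (0 : ℝ) T)}
    (hD : D.Countable) (hD' : Dense D) :
    MeasurableEmbedding fun (x : PathsFrom T x₀) (s : D) ↦ x.1 s := by
  have := hD.to_subtype
  have : PolishSpace (PathsFrom T x₀) := (isClosed_pathsFrom T x₀).polishSpace
  -- Lusin–Souslin: an injective continuous map on a Polish space is a measurable embedding.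
  refine Continuous.measurableEmbedding ?_ fun x y hxy ↦ ?_
  · exact continuous_pi fun s ↦
      (ContinuousMap.evalCLM ℂ (s : Icc (0 : ℝ) T)).continuous.comp continuous_subtype_val
  · refine Subtype.ext (DFunLike.coe_injective ?_)
    exact Continuous.ext_on hD' x.1.continuous y.1.continuous fun s hs ↦ congrFun hxy ⟨s, hs⟩

theorem HasComplexGaussianFDD.unique (hT : 0 ≤ T) (h : HasComplexGaussianFDD x₀ v ν)
    (h' : HasComplexGaussianFDD x₀ v ν') : ν = ν' := by
  have hν := h.isProbabilityMeasure hT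
  obtain ⟨D, hD, hD'⟩ := TopologicalSpace.exists_countable_dense (Icc (0 : ℝ) T)
  have hemb := measurableEmbedding_pathsFrom T x₀ hD hD'
  have hlim (μ : Measure (PathsFrom T x₀)) : IsProjectiveLimit
      (μ.map fun x (s : D) ↦ x.1 s) fun I ↦ μ.map fun x (s : I) ↦ x.1 (s : D) := by
    intro I
    rw [Measure.map_map (by fun_prop) hemb.measurable]
    rfl
  have heq (I : Finset D) : ν.map (fun x (s : I) ↦ x.1 (s : D)) =
      ν'.map (fun x (s : I) ↦ x.1 (s : D)) := by
    classical
    have := h.map_restrict_eq hT h' (I.image Subtype.val)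
    have hg : Measurable fun (y : I.image Subtype.val → ℂ) (s : I) ↦
        y ⟨(s : D), Finset.mem_image_of_mem _ s.2⟩ := by fun_prop
    have hm : Measurable fun (x : PathsFrom T x₀) (s : I.image Subtype.val) ↦ x.1 s :=
      measurable_pi_lambda _ fun _ ↦ measurable_eval_path _
    have h2 := congrArg (Measure.map fun (y : I.image Subtype.val → ℂ) (s : I) ↦
        y ⟨(s : D), Finset.mem_image_of_mem _ s.2⟩) this
    rwa [Measure.map_map hg hm, Measure.map_map hg hm] at h2
  have hmap : ν.map (fun x (s : D) ↦ x.1 s) = ν'.map fun x (s : D) ↦ x.1 s := by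
    have h1 := hlim ν
    simp_rw [heq] at h1
    have (I : Finset D) : IsFiniteMeasure (ν'.map (fun x (s : I) ↦ x.1 (s : D))) := by
      rw [← heq]
      infer_instance
    exact h1.unique (hlim ν')
  rw [← hemb.comap_map ν, hmap, hemb.comap_map]

end Uniqueness

end ComplexWiener

/-! ### The theorem, with Wiener space itself as the probability space -/

theorem mainTheorem6 (T : ℝ) (hT : 0 < T) :
    ∃ (Ω : Type) (mΩ : MeasurableSpace Ω) (P : Measure Ω),
      IsProbabilityMeasure P ∧
      ∃ Z : Ω → ComplexWiener.wienerSpace T,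
        ComplexWiener.IsProperGaussianField Z P ∧
        ComplexWiener.IsComplexBrownianMotion (fun t ω ↦ ComplexWiener.δ t (Z ω)) P ∧
        ∀ x₀ : ℂ,
          (∃! ν : Measure (ComplexWiener.PathsFrom T x₀),
            ComplexWiener.HasComplexGaussianFDD x₀ 2 ν) ∧
          ComplexWiener.HasComplexGaussianFDD x₀ 2
            (P.map fun ω ↦ ComplexWiener.shift x₀ (((√2 : ℝ) : ℂ) • Z ω)) ∧
          (∃! ν : Measure (ComplexWiener.PathsFrom T x₀),
            ComplexWiener.HasComplexGaussianFDD x₀ 1 ν) ∧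
          ComplexWiener.HasComplexGaussianFDD x₀ 1
            (P.map fun ω ↦ ComplexWiener.shift x₀ (Z ω)) := by
  obtain ⟨Q, hQ, hField, hBM⟩ := ComplexWiener.exists_wienerMeasure hT.le
  refine ⟨ComplexWiener.wienerSpace T, inferInstance, Q, hQ, fun z ↦ z, hField, hBM, fun x₀ ↦ ?_⟩
  have hshift : Continuous (ComplexWiener.shift (T := T) x₀) := by
    unfold ComplexWiener.shift
    fun_prop
  have h2 : ComplexWiener.HasComplexGaussianFDD x₀ 2
      (Q.map fun z ↦ ComplexWiener.shift x₀ (((√2 : ℝ) : ℂ) • z)) := by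
    have h := hBM.hasComplexGaussianFDD (c := √2) (x₀ := x₀)
      (Y := fun z ↦ ComplexWiener.shift x₀ (((√2 : ℝ) : ℂ) • z)) (by positivity)
      (hshift.comp (continuous_const_smul _)).measurable (fun z t ↦ rfl)
    rwa [Real.sq_sqrt (by norm_num)] at h
  have h1 : ComplexWiener.HasComplexGaussianFDD x₀ 1
      (Q.map fun z ↦ ComplexWiener.shift x₀ z) := by
    have h := hBM.hasComplexGaussianFDD (c := 1) (x₀ := x₀)
      (Y := fun z ↦ ComplexWiener.shift x₀ z) one_pos hshift.measurable
      (fun z t ↦ by rw [one_smul]; rfl)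
    rwa [one_pow] at h
  exact ⟨⟨_, h2, fun ν hν ↦ hν.unique hT.le h2⟩, h2, ⟨_, h1, fun ν hν ↦ hν.unique hT.le h1⟩, h1⟩
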